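/- Let $K$ be a field of characteristic $0$, let $\mathfrak g$ be a Lie algebra over $K$ (not necessarily finite-dimensional), and let $\mathfrak h\subseteq\mathfrak g$ be a subalgebra of finite codimension, i.e. $(\mathfrak g,\mathfrak h)$ is a transitive pair. Let $Y_1,\dots,Y_n$ be a basis of a vector space complement of $\mathfrak h$ in $\mathfrak g$. For $\alpha\in\mathbb N^n$ write $Y^\alpha:=Y_1^{\alpha_1}\cdots Y_n^{\alpha_n}\in U(\mathfrak g)$, $x^\alpha:=x_1^{\alpha_1}\cdots x_n^{\alpha_n}$ and $\alpha!:=\prod_j\alpha_j!$, and let $e_i\in\mathbb N^n$ be the $i$-th unit vector. Let $A=\operatorname{Hom}_{U(\mathfrak h)}(U(\mathfrak g),K)$, where $U(\mathfrak h)$ acts on $U(\mathfrak g)$ by left multiplication and $K$ is the trivial $\mathfrak h$-module. Every element of $U(\mathfrak g)$ can be written in a unique way as $\sum_{\alpha} u_\alpha Y^\alpha$ with coefficients $u_\alpha\in U(\mathfrak h)$, only finitely many of them non-zero. For each $\alpha\in\mathbb N^n$ there is a unique $a_\alpha\in A$ with $a_\alpha(Y^\alpha)=1$ and $a_\alpha(Y^\beta)=0$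 for all $\beta\neq\alpha$; it sends $\sum_\beta u_\beta Y^\beta$ to the constant part of $u_\alpha$, i.e. to the image of $u_\alpha$ under the algebra homomorphism $U(\mathfrak h)\to K$ that vanishes on $\mathfrak h$. The map $\phi$ sending $X\in\mathfrak g$ to $$\phi(X)=\sum_{i=1}^n\Bigl(\sum_{\alpha\in\mathbb N^n}\frac{a_{e_i}(Y^\alpha X)}{\alpha!}\,x^\alpha\Bigr)\frac{\partial}{\partial x_i}$$ is a realisation of $(\mathfrak g,\mathfrak h)$. That is, $n$ is the codimension of $\mathfrak h$ in $\mathfrak g$, the map $\phi$ is a Lie algebra homomorphism from $\mathfrak g$ to the Lie algebra of $K$-linear derivations of $K[[x_1,\dots,x_n]]$ with the commutator bracket, and $\mathfrak h$ consists exactly of those $X\in\mathfrak g$ for which $\phi(X)$ has non-negative order. Here the order of a derivation $D$ is $-1+\min_i\operatorname{ord}D(x_i)$, where $\operatorname{ord}f$ is the least total degree of a monomial occurring in $f$, and $\operatorname{ord}0=\infty$ (for $n=0$ the minimum is $\infty$). -/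

import Mathlib

noncomputable section

namespace TransitiveLie

/-- The formal vector fields in `n` variables over `K`, i.e. the derivations of
`K[[x₁, …, xₙ]]`, with the commutator bracket. -/
abbrev VectorField (K : Type*) [Field K] (n : ℕ) : Type _ :=
  Derivation K (MvPowerSeries (Fin n) K) (MvPowerSeries (Fin n) K)

/-- The order `-1 + minᵢ ord D(xᵢ)` of a formal vector field; the zero field has order `⊤`. -/
def VectorField.order {K : Type*} [Field K] {n : ℕ} (D : VectorField K n) : WithTop ℤ :=
  ENat.map (Nat.cast : ℕ → ℤ) (⨅ i : Fin n, (D (MvPowerSeries.X i)).order) + ((-1 : ℤ) : WithTop ℤ)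

/-- `(𝔤, 𝔥)` is a transitive pair: the subalgebra `𝔥` has finite codimension in `𝔤`. -/
def IsTransitivePair {K 𝔤 : Type*} [Field K] [LieRing 𝔤] [LieAlgebra K 𝔤]
    (𝔥 : LieSubalgebra K 𝔤) : Prop :=
  FiniteDimensional K (𝔤 ⧸ 𝔥.toSubmodule)

/-- A Lie algebra homomorphism `φ : 𝔤 → Der K[[x₁, …, xₙ]]` is a realisation of `(𝔤, 𝔥)` if
`n` is the codimension of `𝔥` and `𝔥` consists exactly of the elements of `𝔤` that `φ` maps to
vector fields of non-negative order. -/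
structure IsRealisation {K 𝔤 : Type*} [Field K] [LieRing 𝔤] [LieAlgebra K 𝔤]
    (𝔥 : LieSubalgebra K 𝔤) {n : ℕ} (φ : 𝔤 →ₗ⁅K⁆ VectorField K n) : Prop where
  codim_eq : Module.rank K (𝔤 ⧸ 𝔥.toSubmodule) = n
  mem_iff : ∀ X : 𝔤, X ∈ 𝔥 ↔ 0 ≤ (φ X).order

section Enveloping

attribute [local instance] LieRing.ofAssociativeRing

/-- The natural algebra homomorphism `U(𝔥) → U(𝔤)` induced by the inclusion `𝔥 ⊆ 𝔤`. -/
def envelopingIncl {K 𝔤 : Type*} [Field K] [LieRing 𝔤] [LieAlgebra K 𝔤]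
    (𝔥 : LieSubalgebra K 𝔤) :
    UniversalEnvelopingAlgebra K 𝔥 →ₐ[K] UniversalEnvelopingAlgebra K 𝔤 :=
  UniversalEnvelopingAlgebra.lift K ((UniversalEnvelopingAlgebra.ι K).comp 𝔥.incl)

/-- The constant part `U(𝔥) → K`: the action of `U(𝔥)` on the trivial `𝔥`-module `K`. -/
def constantPart {K 𝔤 : Type*} [Field K] [LieRing 𝔤] [LieAlgebra K 𝔤]
    (𝔥 : LieSubalgebra K 𝔤) : UniversalEnvelopingAlgebra K 𝔥 →ₐ[K] K :=
  UniversalEnvelopingAlgebra.lift K (0 : 𝔥 →ₗ⁅K⁆ K)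

/-- The ordered monomial `Y₁^α₁ ⋯ Yₙ^αₙ` in `U(𝔤)`. -/
def orderedMonomial {K 𝔤 : Type*} [Field K] [LieRing 𝔤] [LieAlgebra K 𝔤]
    {n : ℕ} (Y : Fin n → 𝔤) (α : Fin n →₀ ℕ) : UniversalEnvelopingAlgebra K 𝔤 :=
  (List.ofFn fun i => UniversalEnvelopingAlgebra.ι K (Y i) ^ α i).prod

/-- The product `Y₁^α₁ ⋯ Yₙ^αₙ X` in `U(𝔤)`. -/
def orderedMonomialMul (K : Type*) {𝔤 : Type*} [Field K] [LieRing 𝔤] [LieAlgebra K 𝔤]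
    {n : ℕ} (Y : Fin n → 𝔤) (α : Fin n →₀ ℕ) (X : 𝔤) : UniversalEnvelopingAlgebra K 𝔤 :=
  orderedMonomial Y α * UniversalEnvelopingAlgebra.ι K X

end Enveloping

/-- The `U(𝔥)`-linear combination `∑ u_α Y₁^α₁ ⋯ Yₙ^αₙ` in `U(𝔤)` of ordered monomials, with
finitely many non-zero coefficients `u_α` in `U(𝔥)`. -/
def combination {K 𝔤 : Type*} [Field K] [LieRing 𝔤] [LieAlgebra K 𝔤]
    (𝔥 : LieSubalgebra K 𝔤) {n : ℕ} (Y : Fin n → 𝔤)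
    (u : (Fin n →₀ ℕ) →₀ UniversalEnvelopingAlgebra K 𝔥) : UniversalEnvelopingAlgebra K 𝔤 :=
  u.sum fun α v => envelopingIncl 𝔥 v * orderedMonomial Y α

/-- The space `A = Hom_{U(𝔥)}(U(𝔤), K)`, where `U(𝔥)` acts on `U(𝔤)` by left multiplication and
`K` is the trivial module. -/
def coinduced {K 𝔤 : Type*} [Field K] [LieRing 𝔤] [LieAlgebra K 𝔤]
    (𝔥 : LieSubalgebra K 𝔤) : Submodule K (UniversalEnvelopingAlgebra K 𝔤 →ₗ[K] K) where
  carrier := {a | ∀ (v : UniversalEnvelopingAlgebra K 𝔥) (u : UniversalEnvelopingAlgebra K 𝔤),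
    a (envelopingIncl 𝔥 v * u) = constantPart 𝔥 v * a u}
  add_mem' := by
    intro a b ha hb v u
    simp only [LinearMap.add_apply, ha v u, hb v u, mul_add]
  zero_mem' := by
    intro v u
    simp
  smul_mem' := by
    intro c a ha v u
    simp only [LinearMap.smul_apply, ha v u, smul_eq_mul]
    ring

/-- `a` is an element of `A` that assigns `1` to `Y^α` and `0` to all other ordered monomials. -/
def IsDualFunctional {K 𝔤 : Type*} [Field K] [LieRing 𝔤] [LieAlgebra K 𝔤]
    (𝔥 : LieSubalgebra K 𝔤) {n : ℕ} (Y : Fin n → 𝔤) (α : Fin n →₀ ℕ)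
    (a : UniversalEnvelopingAlgebra K 𝔤 →ₗ[K] K) : Prop :=
  a ∈ coinduced 𝔥 ∧ a (orderedMonomial Y α) = 1 ∧ ∀ β, β ≠ α → a (orderedMonomial Y β) = 0

/-- The functional `a_α`: the unique one satisfying `IsDualFunctional`.  (It is chosen here by
`Classical.epsilon`; its existence and uniqueness have to be proved.) -/
def dualFunctional {K 𝔤 : Type*} [Field K] [LieRing 𝔤] [LieAlgebra K 𝔤]
    (𝔥 : LieSubalgebra K 𝔤) {n : ℕ} (Y : Fin n → 𝔤) (α : Fin n →₀ ℕ) :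
    UniversalEnvelopingAlgebra K 𝔤 →ₗ[K] K :=
  Classical.epsilon (IsDualFunctional 𝔥 Y α)

/-- The power series `∑_α a_{eᵢ}(Y₁^α₁ ⋯ Yₙ^αₙ X) / α! · x^α` (a power series is by definition
the function sending an exponent to its coefficient). -/
def realisationCoeff {K 𝔤 : Type*} [Field K] [LieRing 𝔤] [LieAlgebra K 𝔤]
    (𝔥 : LieSubalgebra K 𝔤) {n : ℕ} (Y : Fin n → 𝔤) (X : 𝔤) (i : Fin n) :
    MvPowerSeries (Fin n) K :=
  fun α => dualFunctional 𝔥 Y (Finsupp.single i 1) (orderedMonomialMul K Y α X) /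
    ((∏ j, (α j).factorial : ℕ) : K)

/-- The vector field `∑ᵢ (∑_α a_{eᵢ}(Y₁^α₁ ⋯ Yₙ^αₙ X) / α! · x^α) ∂/∂xᵢ`. -/
def realisationFormula {K 𝔤 : Type*} [Field K] [LieRing 𝔤] [LieAlgebra K 𝔤]
    (𝔥 : LieSubalgebra K 𝔤) {n : ℕ} (Y : Fin n → 𝔤) (X : 𝔤) : VectorField K n :=
  ∑ i, realisationCoeff 𝔥 Y X i • MvPowerSeries.pderiv K i

end TransitiveLie

end

/-! Apply Poincaré–Birkhoff–Witt to a basis of 𝔤 in which a basis of 𝔥 precedes the `Y i`: U(𝔤) is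
free as a left U(𝔥)-module on the monomials Y^α (`combinationMap_bijective`). An element of A is
therefore an arbitrary family of values on the Y^α, and a ↦ ∑ a(Y^α)/α! x^α is a linear isomorphism
from A to K[[x]] (`taylor_bijective`). Characteristic 0 makes the α! invertible.

Convolution along the coproduct of U(𝔤) preserves A, and Δ(Y^α/α!) = ∑_{β+γ=α} Y^β/β! ⊗ Y^γ/γ! makes
the isomorphism multiplicative (`taylor_convolution`). Each X ∈ 𝔤 acts on A by (X·a)(u) = a(uX); as
X is primitive, this is a derivation (`translate_convolution`). Transport to K[[x]] gives a Lie
algebra homomorphism into the vector fields. Since x_i is the Taylor series of a_{e_i}, X sends x_i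
to the i-th coefficient of the formula. A derivation is determined by its values on the variables
(`VectorField.eq_of_apply_X`), so the formula is this action (`realisationFormula_eq`).

The constant term of φ(X)x_i is a_{e_i}(X), the Y_i-coordinate of X modulo 𝔥. These all vanish
exactly when X ∈ 𝔥. -/

noncomputable section

namespace TransitiveLie

/-! ### The action of a Lie algebra on the span of multisets of basis indices. -/

section PBW

variable {K L ι : Type*} [Field K] [LieRing L] [LieAlgebra K L]

/-- The span of the multisets of cardinality at most `p`. -/
def degreeLE (K ι : Type*) [Field K] (p : ℕ) : Submodule K (Multiset ι →₀ K) :=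
  Submodule.span K ((fun m => Finsupp.single m 1) '' {m | Multiset.card m ≤ p})

theorem single_mem_degreeLE {m : Multiset ι} {p : ℕ} (h : Multiset.card m ≤ p) :
    (Finsupp.single m 1 : Multiset ι →₀ K) ∈ degreeLE K ι p :=
  Submodule.subset_span ⟨m, h, rfl⟩

theorem degreeLE_mono {p q : ℕ} (h : p ≤ q) : degreeLE K ι p ≤ degreeLE K ι q :=
  Submodule.span_mono (Set.image_mono fun _ hm => le_trans hm h)

theorem map_mem_of_degreeLE {N : Type*} [AddCommGroup N] [Module K N]
    (f : (Multiset ι →₀ K) →ₗ[K] N) (S : Submodule K N) {p : ℕ}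
    (h : ∀ m, Multiset.card m ≤ p → f (Finsupp.single m 1) ∈ S)
    {w : Multiset ι →₀ K} (hw : w ∈ degreeLE K ι p) : f w ∈ S := by
  have : degreeLE K ι p ≤ S.comap f := by
    rw [degreeLE, Submodule.span_le]
    rintro _ ⟨m, hm, rfl⟩
    exact h m hm
  exact this hw

theorem eq_of_degreeLE {N : Type*} [AddCommGroup N] [Module K N]
    (f g : (Multiset ι →₀ K) →ₗ[K] N) {p : ℕ}
    (h : ∀ m, Multiset.card m ≤ p → f (Finsupp.single m 1) = g (Finsupp.single m 1))
    {w : Multiset ι →₀ K} (hw : w ∈ degreeLE K ι p) : f w = g w := by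
  have := map_mem_of_degreeLE (f - g) ⊥ (fun m hm => by simp [h m hm]) hw
  simpa [sub_eq_zero] using this

/-- The operators on the space of multisets that add the element `i` to `m`, up to a correction
term `D i m`, for the basis vectors `B i`. -/
def shiftOperator (B : Module.Basis ι K L) (D : ι → Multiset ι → Multiset ι →₀ K) :
    L →ₗ[K] (Multiset ι →₀ K) →ₗ[K] (Multiset ι →₀ K) :=
  B.constr K fun i => Finsupp.linearCombination K fun m => Finsupp.single (i ::ₘ m) 1 + D i m

theorem shiftOperator_basis (B : Module.Basis ι K L) (D : ι → Multiset ι → Multiset ι →₀ K)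
    (i : ι) (m : Multiset ι) :
    shiftOperator B D (B i) (Finsupp.single m 1) = Finsupp.single (i ::ₘ m) 1 + D i m := by
  simp [shiftOperator, Module.Basis.constr_basis]

theorem shiftOperator_mem (B : Module.Basis ι K L) {D : ι → Multiset ι → Multiset ι →₀ K} {p : ℕ}
    (hD : ∀ i m, Multiset.card m ≤ p → D i m ∈ degreeLE K ι (Multiset.card m))
    (x : L) {w : Multiset ι →₀ K} (hw : w ∈ degreeLE K ι p) :
    shiftOperator B D x w ∈ degreeLE K ι (p + 1) := by
  refine map_mem_of_degreeLE _ _ (fun m hm => ?_) hw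
  have : ⊤ ≤ (degreeLE K ι (p + 1)).comap ((shiftOperator B D).flip (Finsupp.single m 1)) := by
    rw [← B.span_eq, Submodule.span_le]
    rintro _ ⟨i, rfl⟩
    simp only [SetLike.mem_coe, Submodule.mem_comap, LinearMap.flip_apply, shiftOperator_basis]
    exact add_mem (single_mem_degreeLE (by simpa using hm))
      (degreeLE_mono (by omega) (hD i m hm))
  exact this (Submodule.mem_top (x := x))

theorem shiftOperator_congr (B : Module.Basis ι K L) {D D' : ι → Multiset ι → Multiset ι →₀ K}
    {p : ℕ} (hD : ∀ i m, Multiset.card m ≤ p → D i m = D' i m)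
    (x : L) {w : Multiset ι →₀ K} (hw : w ∈ degreeLE K ι p) :
    shiftOperator B D x w = shiftOperator B D' x w := by
  refine eq_of_degreeLE _ _ (fun m hm => ?_) hw
  have : (shiftOperator B D).flip (Finsupp.single m 1) =
      (shiftOperator B D').flip (Finsupp.single m 1) :=
    B.ext fun i => by simp [shiftOperator_basis, hD i m hm]
  exact LinearMap.congr_fun this x

theorem bilinear_ext_basis (B : Module.Basis ι K L) {N : Type*} [AddCommGroup N] [Module K N]
    (f g : L →ₗ[K] L →ₗ[K] N) (h : ∀ i j, f (B i) (B j) = g (B i) (B j)) : f = g :=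
  B.ext fun i => B.ext fun j => h i j

variable [LinearOrder ι]

/-- The correction terms of the action of `L` on the space of multisets, for multisets of
cardinality at most `n`. -/
def correction (B : Module.Basis ι K L) : ℕ → ι → Multiset ι → Multiset ι →₀ K
  -- The true value for the empty multiset, a default for all larger ones.
  | 0, _, _ => 0
  | n + 1, i, m =>
    match m.sort (· ≤ ·) with
    | [] => 0
    | j :: l =>
      if i ≤ j then 0
      -- Forced by B i · (j, l) = B j · (B i · l) + [B i, B j] · l: the leading term of B i · l is i
      -- ::ₘ l, and on it B j acts without correction.
      else shiftOperator B (correction B n) (B j) (correction B n i l) +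
        shiftOperator B (correction B n) ⁅B i, B j⁆ (Finsupp.single (l : Multiset ι) 1)

theorem sort_cons_of_le {i : ι} {m : Multiset ι} (h : ∀ k ∈ m, i ≤ k) :
    (i ::ₘ m).sort (· ≤ ·) = i :: m.sort (· ≤ ·) :=
  Multiset.sort_cons _ _ _ h

theorem correction_of_le (B : Module.Basis ι K L) (n : ℕ) {i : ι} {m : Multiset ι}
    (h : ∀ k ∈ m, i ≤ k) : correction B n i m = 0 := by
  cases n with
  | zero => rfl
  | succ n =>
    rw [correction]
    cases hs : m.sort (· ≤ ·) with
    | nil => rfl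
    | cons j l =>
      have : j ∈ m := by rw [← Multiset.mem_sort (r := (· ≤ ·)), hs]; simp
      simp [h j this]

theorem correction_cons (B : Module.Basis ι K L) (n : ℕ) {i j : ι} {l : Multiset ι}
    (hij : j < i) (hl : ∀ k ∈ l, j ≤ k) :
    correction B (n + 1) i (j ::ₘ l) =
      shiftOperator B (correction B n) (B j) (correction B n i l) +
        shiftOperator B (correction B n) ⁅B i, B j⁆ (Finsupp.single l 1) := by
  rw [correction, sort_cons_of_le hl]
  simp [not_le.2 hij]

theorem exists_min_cons {m : Multiset ι} (h : m ≠ 0) :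
    ∃ j l, m = j ::ₘ l ∧ ∀ k ∈ l, j ≤ k := by
  have hs := m.sort_eq (· ≤ ·)
  have hp := m.pairwise_sort (· ≤ ·)
  cases hc : m.sort (· ≤ ·) with
  | nil => rw [hc] at hs; exact absurd hs.symm h
  | cons j l =>
    rw [hc] at hs hp
    exact ⟨j, l, hs.symm, fun k hk => List.rel_of_pairwise_cons hp hk⟩

/-- Case distinction: `i` is at most all elements of `m`, or `m` has a minimum below `i`. -/
theorem le_or_exists_min_lt (i : ι) (m : Multiset ι) :
    (∀ k ∈ m, i ≤ k) ∨ ∃ j l, m = j ::ₘ l ∧ (∀ k ∈ l, j ≤ k) ∧ j < i := by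
  by_cases h : ∀ k ∈ m, i ≤ k
  · exact Or.inl h
  · right
    push Not at h
    obtain ⟨k, hk, hki⟩ := h
    obtain ⟨j, l, rfl, hl⟩ := exists_min_cons (m := m) (by rintro rfl; simp at hk)
    refine ⟨j, l, rfl, hl, lt_of_le_of_lt ?_ hki⟩
    rcases Multiset.mem_cons.1 hk with rfl | hk
    · exact le_rfl
    · exact hl k hk

/-- A shift raises the degree by at most one, so straightening j ::ₘ l never exceeds its
cardinality. Hence the recursion uses lower stages only where they are already final. -/
theorem correction_mem (B : Module.Basis ι K L) (n : ℕ) (i : ι) (m : Multiset ι) :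
    correction B n i m ∈ degreeLE K ι (Multiset.card m) := by
  induction n generalizing i m with
  | zero => exact zero_mem _
  | succ n ih =>
    rcases le_or_exists_min_lt i m with h | ⟨j, l, rfl, hl, hij⟩
    · rw [correction_of_le B _ h]
      exact zero_mem _
    · rw [correction_cons B n hij hl, Multiset.card_cons]
      exact add_mem (shiftOperator_mem B (fun i m _ => ih i m) _ (ih i l))
        (shiftOperator_mem B (fun i m _ => ih i m) _ (single_mem_degreeLE le_rfl))

theorem correction_succ (B : Module.Basis ι K L) (n : ℕ) (i : ι) (m : Multiset ι)
    (hm : Multiset.card m ≤ n) : correction B (n + 1) i m = correction B n i m := by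
  induction n generalizing i m with
  | zero =>
    obtain rfl : m = 0 := Multiset.card_eq_zero.1 (by omega)
    rw [correction_of_le B _ (by simp), correction_of_le B _ (by simp)]
  | succ n ih =>
    rcases le_or_exists_min_lt i m with h | ⟨j, l, rfl, hl, hij⟩
    · rw [correction_of_le B _ h, correction_of_le B _ h]
    · have hln : Multiset.card l ≤ n := by simpa using hm
      rw [correction_cons B _ hij hl, correction_cons B _ hij hl, ih i l hln,
        shiftOperator_congr B (fun i m h => ih i m h) (B j)
          (degreeLE_mono hln (correction_mem B n i l)),
        shiftOperator_congr B (fun i m h => ih i m h) ⁅B i, B j⁆ (single_mem_degreeLE hln)]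

theorem correction_eq (B : Module.Basis ι K L) {n : ℕ} (i : ι) {m : Multiset ι}
    (hm : Multiset.card m ≤ n) : correction B n i m = correction B (Multiset.card m) i m := by
  induction n, hm using Nat.le_induction with
  | base => rfl
  | succ n hn ih => rw [correction_succ B n i m hn, ih]

/-- The action of `L` on the space of multisets. -/
def multisetAction (B : Module.Basis ι K L) :
    L →ₗ[K] (Multiset ι →₀ K) →ₗ[K] (Multiset ι →₀ K) :=
  shiftOperator B fun i m => correction B (Multiset.card m) i m

theorem multisetAction_eq (B : Module.Basis ι K L) (n : ℕ) (x : L) {w : Multiset ι →₀ K}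
    (hw : w ∈ degreeLE K ι n) :
    multisetAction B x w = shiftOperator B (correction B n) x w :=
  shiftOperator_congr B (fun i _ h => (correction_eq B i h).symm) x hw

theorem multisetAction_of_le (B : Module.Basis ι K L) {i : ι} {m : Multiset ι}
    (h : ∀ k ∈ m, i ≤ k) :
    multisetAction B (B i) (Finsupp.single m 1) = Finsupp.single (i ::ₘ m) 1 := by
  rw [multisetAction, shiftOperator_basis, correction_of_le B _ h, add_zero]

theorem exists_multisetAction_eq (B : Module.Basis ι K L) (i : ι) (m : Multiset ι) :
    ∃ w ∈ degreeLE K ι (Multiset.card m),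
      multisetAction B (B i) (Finsupp.single m 1) = Finsupp.single (i ::ₘ m) 1 + w :=
  ⟨_, correction_mem B _ i m, shiftOperator_basis B _ i m⟩

/-- The commutation relation in the case built into the correction terms. The other cases are
deduced from it. -/
theorem multisetAction_cons (B : Module.Basis ι K L) {i j : ι} {l : Multiset ι}
    (hij : j < i) (hl : ∀ k ∈ l, j ≤ k) :
    multisetAction B (B i) (Finsupp.single (j ::ₘ l) 1) =
      multisetAction B (B j) (multisetAction B (B i) (Finsupp.single l 1)) +
        multisetAction B ⁅B i, B j⁆ (Finsupp.single l 1) := by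
  have hc : correction B (Multiset.card l) i l ∈ degreeLE K ι (Multiset.card l) :=
    correction_mem B _ i l
  have h1 : multisetAction B (B i) (Finsupp.single l 1) =
      Finsupp.single (i ::ₘ l) 1 + correction B (Multiset.card l) i l :=
    shiftOperator_basis B _ i l
  have h2 : ∀ k ∈ i ::ₘ l, j ≤ k := by
    intro k hk
    rcases Multiset.mem_cons.1 hk with rfl | hk
    · exact hij.le
    · exact hl k hk
  rw [h1, map_add, multisetAction_of_le B h2, multisetAction_eq B _ (B j) hc,
    multisetAction_eq B _ ⁅B i, B j⁆ (single_mem_degreeLE le_rfl), add_assoc,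
    ← correction_cons B _ hij hl, Multiset.cons_swap, multisetAction, shiftOperator_basis,
    Multiset.card_cons]

/-- If j is at most every element of m, this is `multisetAction_cons`. Otherwise m = k ::ₘ l with k
minimal and k < j < i; write it as B k · l and move both operators past B k. The terms of lower
degree obey the induction hypothesis, and the double brackets match by the Jacobi identity. -/
theorem multisetAction_lie_aux (B : Module.Basis ι K L) (m : Multiset ι)
    (ih : ∀ (x y : L) (w : Multiset ι →₀ K) (p : ℕ), p < Multiset.card m → w ∈ degreeLE K ι p →
      multisetAction B x (multisetAction B y w) =
        multisetAction B y (multisetAction B x w) + multisetAction B ⁅x, y⁆ w)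
    {i j : ι} (hji : j < i) :
    multisetAction B (B i) (multisetAction B (B j) (Finsupp.single m 1)) =
      multisetAction B (B j) (multisetAction B (B i) (Finsupp.single m 1)) +
        multisetAction B ⁅B i, B j⁆ (Finsupp.single m 1) := by
  rcases le_or_exists_min_lt j m with h | ⟨k, l, rfl, hl, hkj⟩
  · rw [multisetAction_of_le B h, multisetAction_cons B hji h]
  · have hki := hkj.trans hji
    have hlt : Multiset.card l < Multiset.card (k ::ₘ l) := by simp
    have hz : (Finsupp.single l 1 : Multiset ι →₀ K) ∈ degreeLE K ι (Multiset.card l) :=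
      single_mem_degreeLE le_rfl
    -- moving `B i` past `B k` when applied to `B j • l`
    have key : ∀ i j : ι, k < i → k < j →
        multisetAction B (B i) (multisetAction B (B k)
          (multisetAction B (B j) (Finsupp.single l 1))) =
        multisetAction B (B k) (multisetAction B (B i)
          (multisetAction B (B j) (Finsupp.single l 1))) +
        multisetAction B ⁅B i, B k⁆ (multisetAction B (B j) (Finsupp.single l 1)) := by
      intro i j hki hkj
      obtain ⟨w, hw, hjl⟩ := exists_multisetAction_eq B j l
      have h2 : ∀ k' ∈ j ::ₘ l, k ≤ k' := by
        intro k' hk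
        rcases Multiset.mem_cons.1 hk with rfl | hk
        · exact hkj.le
        · exact hl k' hk
      rw [hjl]
      simp only [map_add]
      rw [ih (B i) (B k) w _ hlt hw, multisetAction_of_le B h2, multisetAction_cons B hki h2]
      abel
    rw [multisetAction_cons B hkj hl, multisetAction_cons B hki hl]
    simp only [map_add]
    rw [key i j hki hkj, key j i hkj hki, ih (B i) ⁅B j, B k⁆ _ _ hlt hz,
      ih (B j) ⁅B i, B k⁆ _ _ hlt hz, ih (B i) (B j) _ _ hlt hz,
      ← multisetAction_of_le B hl, ih ⁅B i, B j⁆ (B k) _ _ hlt hz]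
    simp only [map_add]
    have jac : multisetAction B ⁅B i, ⁅B j, B k⁆⁆ (Finsupp.single l 1) =
        multisetAction B ⁅B j, ⁅B i, B k⁆⁆ (Finsupp.single l 1) +
        multisetAction B ⁅⁅B i, B j⁆, B k⁆ (Finsupp.single l 1) := by
      rw [← LinearMap.add_apply, ← map_add]
      congr 2
      rw [leibniz_lie (B i) (B j) (B k)]
      abel
    rw [jac]
    abel

theorem multisetAction_lie_single (B : Module.Basis ι K L) (x y : L) (m : Multiset ι) :
    multisetAction B x (multisetAction B y (Finsupp.single m 1)) =
      multisetAction B y (multisetAction B x (Finsupp.single m 1)) +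
        multisetAction B ⁅x, y⁆ (Finsupp.single m 1) := by
  induction hn : Multiset.card m using Nat.strong_induction_on generalizing x y m with
  | _ n ih =>
  have ih' : ∀ (x y : L) (w : Multiset ι →₀ K) (p : ℕ), p < Multiset.card m →
      w ∈ degreeLE K ι p →
      multisetAction B x (multisetAction B y w) =
        multisetAction B y (multisetAction B x w) + multisetAction B ⁅x, y⁆ w := by
    intro x y w p hp hw
    exact eq_of_degreeLE (multisetAction B x ∘ₗ multisetAction B y)
      (multisetAction B y ∘ₗ multisetAction B x + multisetAction B ⁅x, y⁆)
      (fun m' hm' => ih _ (by omega) x y m' rfl) hw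
  have hb : ∀ i j,
      multisetAction B (B i) (multisetAction B (B j) (Finsupp.single m 1)) =
      multisetAction B (B j) (multisetAction B (B i) (Finsupp.single m 1)) +
        multisetAction B ⁅B i, B j⁆ (Finsupp.single m 1) := by
    intro i j
    rcases lt_trichotomy j i with h | rfl | h
    · exact multisetAction_lie_aux B m ih' h
    · simp
    · rw [multisetAction_lie_aux B m ih' h, ← lie_skew (B i) (B j), map_neg, LinearMap.neg_apply]
      abel
  -- Both sides are bilinear in x and y, so the identity on basis pairs suffices.
  let ev := (multisetAction B).flip (Finsupp.single m 1)
  let f : L →ₗ[K] L →ₗ[K] (Multiset ι →₀ K) := (multisetAction B).compl₂ ev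
  have := bilinear_ext_basis B f
    (f.flip + (LieModule.toEnd K L L : L →ₗ[K] Module.End K L).compr₂ ev)
    (fun i j => by simpa [f, ev] using hb i j)
  simpa [f, ev] using LinearMap.congr_fun (LinearMap.congr_fun this x) y

end PBW

/-! ### The representation of U(L) and the Poincaré–Birkhoff–Witt theorem. -/

section PBW

attribute [local instance] LieRing.ofAssociativeRing

/-- The elements satisfying `P` form a subalgebra containing the image of L. By the universal
property the identity of U(L) factors through it. -/
theorem enveloping_induction {K L : Type*} [Field K] [LieRing L] [LieAlgebra K L]
    {P : UniversalEnvelopingAlgebra K L → Prop}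
    (algebraMap : ∀ c, P (algebraMap K _ c)) (ι : ∀ x, P (UniversalEnvelopingAlgebra.ι K x))
    (add : ∀ u v, P u → P v → P (u + v)) (mul : ∀ u v, P u → P v → P (u * v))
    (u : UniversalEnvelopingAlgebra K L) : P u := by
  let S : Subalgebra K (UniversalEnvelopingAlgebra K L) :=
    { carrier := {u | P u}
      mul_mem' := fun hu hv => mul _ _ hu hv
      add_mem' := fun hu hv => add _ _ hu hv
      algebraMap_mem' := algebraMap }
  let f : L →ₗ⁅K⁆ S :=
    { toFun := fun x => ⟨UniversalEnvelopingAlgebra.ι K x, ι x⟩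
      map_add' := fun x y => Subtype.ext (map_add _ x y)
      map_smul' := fun c x => Subtype.ext (map_smul _ c x)
      map_lie' := fun {x y} => Subtype.ext (LieHom.map_lie _ x y) }
  have h : S.val.comp (UniversalEnvelopingAlgebra.lift K f) = AlgHom.id K _ := by
    apply UniversalEnvelopingAlgebra.hom_ext
    ext x
    exact congrArg Subtype.val (UniversalEnvelopingAlgebra.lift_ι_apply K f x)
  have h' : (UniversalEnvelopingAlgebra.lift K f u : UniversalEnvelopingAlgebra K L) = u :=
    AlgHom.congr_fun h u
  exact h' ▸ (UniversalEnvelopingAlgebra.lift K f u).2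

variable {K L ι : Type*} [Field K] [LieRing L] [LieAlgebra K L] [LinearOrder ι]

theorem multisetAction_lie (B : Module.Basis ι K L) (x y : L) :
    multisetAction B ⁅x, y⁆ = ⁅multisetAction B x, multisetAction B y⁆ := by
  refine Finsupp.lhom_ext' fun m => LinearMap.ext_ring ?_
  simp [multisetAction_lie_single B x y m]

/-- The representation of `U(L)` on the space of multisets. -/
def multisetRep (B : Module.Basis ι K L) :
    UniversalEnvelopingAlgebra K L →ₐ[K] Module.End K (Multiset ι →₀ K) :=
  UniversalEnvelopingAlgebra.lift K
    { multisetAction B with map_lie' := fun {x y} => multisetAction_lie B x y }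

theorem multisetRep_ι (B : Module.Basis ι K L) (x : L) :
    multisetRep B (UniversalEnvelopingAlgebra.ι K x) = multisetAction B x :=
  UniversalEnvelopingAlgebra.lift_ι_apply K _ x

/-- The ordered product in `U(L)` of the basis vectors with index in the multiset `m`. -/
def sortedProduct (B : Module.Basis ι K L) (m : Multiset ι) : UniversalEnvelopingAlgebra K L :=
  ((m.sort (· ≤ ·)).map fun i => UniversalEnvelopingAlgebra.ι K (B i)).prod

theorem sortedProduct_cons (B : Module.Basis ι K L) {i : ι} {m : Multiset ι}
    (h : ∀ k ∈ m, i ≤ k) :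
    sortedProduct B (i ::ₘ m) = UniversalEnvelopingAlgebra.ι K (B i) * sortedProduct B m := by
  simp [sortedProduct, sort_cons_of_le h]

/-- Each factor acts on a multiset of elements not below its index, so no correction occurs. This
gives linear independence of the ordered products. -/
theorem multisetRep_sortedProduct (B : Module.Basis ι K L) (m : Multiset ι) :
    multisetRep B (sortedProduct B m) (Finsupp.single 0 1) = Finsupp.single m 1 := by
  induction hn : Multiset.card m generalizing m with
  | zero =>
    obtain rfl := Multiset.card_eq_zero.1 hn
    simp [sortedProduct]
  | succ n ih =>
    obtain ⟨j, l, rfl, hl⟩ := exists_min_cons (m := m) (by rintro rfl; simp at hn)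
    rw [sortedProduct_cons B hl, map_mul, Module.End.mul_apply, ih l (by simpa using hn),
      multisetRep_ι, multisetAction_of_le B hl]

/-- The linear map sending a multiset to its ordered product. -/
def sortedProductMap (B : Module.Basis ι K L) :
    (Multiset ι →₀ K) →ₗ[K] UniversalEnvelopingAlgebra K L :=
  Finsupp.linearCombination K (sortedProduct B)

theorem sortedProductMap_action_single (B : Module.Basis ι K L) (x : L) (m : Multiset ι) :
    sortedProductMap B (multisetAction B x (Finsupp.single m 1)) =
      UniversalEnvelopingAlgebra.ι K x * sortedProduct B m := by
  induction hn : Multiset.card m using Nat.strong_induction_on generalizing x m with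
  | _ n ih =>
  suffices h : sortedProductMap B ∘ₗ (multisetAction B).flip (Finsupp.single m 1) =
      LinearMap.mulRight K (sortedProduct B m) ∘ₗ
        (UniversalEnvelopingAlgebra.ι K : L →ₗ⁅K⁆ UniversalEnvelopingAlgebra K L) from
    LinearMap.congr_fun h x
  refine B.ext fun i => ?_
  simp only [LinearMap.comp_apply, LinearMap.flip_apply, LinearMap.mulRight_apply,
    LieHom.coe_toLinearMap]
  rcases le_or_exists_min_lt i m with h | ⟨j, l, rfl, hl, hij⟩
  · rw [multisetAction_of_le B h, ← sortedProduct_cons B h]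
    simp [sortedProductMap]
  · have hlt : Multiset.card l < n := by simp at hn; omega
    obtain ⟨w, hw, hil⟩ := exists_multisetAction_eq B i l
    have h2 : ∀ k ∈ i ::ₘ l, j ≤ k := by
      intro k hk
      rcases Multiset.mem_cons.1 hk with rfl | hk
      · exact hij.le
      · exact hl k hk
    have hw' : sortedProductMap B (multisetAction B (B j) w) =
        UniversalEnvelopingAlgebra.ι K (B j) * sortedProductMap B w :=
      eq_of_degreeLE (sortedProductMap B ∘ₗ multisetAction B (B j))
        (LinearMap.mulLeft K (UniversalEnvelopingAlgebra.ι K (B j)) ∘ₗ sortedProductMap B)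
        (fun m' hm' => by
          simpa [sortedProductMap] using ih _ (by omega) (B j) m' rfl) hw
    -- The induction hypothesis does not cover i ::ₘ l, which is as large as m; but j is minimal
    -- there, so its product splits directly. The remainder w has lower degree.
    have hA : sortedProductMap B (multisetAction B (B j)
        (multisetAction B (B i) (Finsupp.single l 1))) =
        UniversalEnvelopingAlgebra.ι K (B j) *
          sortedProductMap B (multisetAction B (B i) (Finsupp.single l 1)) := by
      rw [hil]
      simp only [map_add, mul_add, hw', multisetAction_of_le B h2]
      simp [sortedProductMap, sortedProduct_cons B h2]
    rw [multisetAction_cons B hij hl, map_add, hA, ih _ hlt _ l rfl, ih _ hlt _ l rfl,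
      LieHom.map_lie, sortedProduct_cons B hl, LieRing.of_associative_ring_bracket]
    noncomm_ring

theorem sortedProductMap_rep (B : Module.Basis ι K L) (u : UniversalEnvelopingAlgebra K L)
    (w : Multiset ι →₀ K) :
    sortedProductMap B (multisetRep B u w) = u * sortedProductMap B w := by
  induction u using enveloping_induction generalizing w with
  | algebraMap c => simp [Algebra.smul_def]
  | ι x =>
    rw [multisetRep_ι]
    suffices h : sortedProductMap B ∘ₗ multisetAction B x =
        LinearMap.mulLeft K (UniversalEnvelopingAlgebra.ι K x) ∘ₗ sortedProductMap B from
      LinearMap.congr_fun h w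
    refine Finsupp.lhom_ext' fun m => LinearMap.ext_ring ?_
    simpa [sortedProductMap] using sortedProductMap_action_single B x m
  | add u v hu hv => simp [hu, hv, add_mul]
  | mul u v hu hv => simp [hu, hv, mul_assoc]

/-- The Poincaré–Birkhoff–Witt theorem. -/
theorem sortedProductMap_bijective (B : Module.Basis ι K L) :
    Function.Bijective (sortedProductMap B) := by
  constructor
  · have h : (multisetRep B).toLinearMap.flip (Finsupp.single 0 1) ∘ₗ sortedProductMap B =
        LinearMap.id := by
      refine Finsupp.lhom_ext' fun m => LinearMap.ext_ring ?_
      simpa [sortedProductMap] using multisetRep_sortedProduct B m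
    exact Function.LeftInverse.injective
      (g := (multisetRep B).toLinearMap.flip (Finsupp.single 0 1)) fun w => LinearMap.congr_fun h w
  · intro u
    -- The empty multiset has product 1, so the intertwining property returns u · 1.
    refine ⟨multisetRep B u (Finsupp.single 0 1), ?_⟩
    rw [sortedProductMap_rep]
    simp [sortedProductMap, sortedProduct]

/-- The basis of `U(L)` consisting of ordered products. -/
def pbwBasis (B : Module.Basis ι K L) :
    Module.Basis (Multiset ι) K (UniversalEnvelopingAlgebra K L) :=
  .ofRepr (LinearEquiv.ofBijective _ (sortedProductMap_bijective B)).symm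

theorem pbwBasis_apply (B : Module.Basis ι K L) (m : Multiset ι) :
    pbwBasis B m = sortedProduct B m := by
  change sortedProductMap B (Finsupp.single m 1) = _
  simp [sortedProductMap]

end PBW

/-! ### Freeness of U(𝔤) over U(𝔥) and the dual functionals. -/

section Combination

attribute [local instance] LieRing.ofAssociativeRing

/-- The multiset on the ordered sum `κ ⊕ₗ σ` with parts `s` and `α`. -/
def lexMultiset {κ σ : Type*} (p : (_ : σ →₀ ℕ) × Multiset κ) : Multiset (κ ⊕ₗ σ) :=
  p.2.map Sum.inlₗ + (Finsupp.toMultiset p.1).map Sum.inrₗ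

theorem lexMultiset_bijective (κ σ : Type*) :
    Function.Bijective (lexMultiset : (_ : σ →₀ ℕ) × Multiset κ → Multiset (κ ⊕ₗ σ)) := by
  classical
  have hl : Function.Injective (Sum.inlₗ : κ → κ ⊕ₗ σ) := toLex.injective.comp Sum.inl_injective
  have hr : Function.Injective (Sum.inrₗ : σ → κ ⊕ₗ σ) := toLex.injective.comp Sum.inr_injective
  constructor
  · rintro ⟨α, s⟩ ⟨β, t⟩ h
    have h1 : s = t := by
      ext k
      have := congrArg (Multiset.count (Sum.inlₗ k)) h
      simpa [lexMultiset, Multiset.count_map_eq_count' _ _ hl, Multiset.count_eq_zero] using this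
    have h2 : Finsupp.toMultiset α = Finsupp.toMultiset β := by
      ext k
      have := congrArg (Multiset.count (Sum.inrₗ k)) h
      simpa [lexMultiset, Multiset.count_map_eq_count' _ _ hr, Multiset.count_eq_zero] using this
    rw [h1, Finsupp.orderIsoMultiset.injective h2]
  · intro m
    induction m using Multiset.induction_on with
    | empty => exact ⟨⟨0, 0⟩, by simp [lexMultiset]⟩
    | cons a m ih =>
      obtain ⟨⟨α, s⟩, rfl⟩ := ih
      rcases a with k | i
      · refine ⟨⟨α, k ::ₘ s⟩, ?_⟩
        simp [lexMultiset]; rfl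
      · refine ⟨⟨Finsupp.single i 1 + α, s⟩, ?_⟩
        simp [lexMultiset]; rfl

/-- Left summands precede right ones, so an ordered product factors into one from U(𝔥) followed by
an ordered monomial in the `Y i`. -/
theorem sort_lexMultiset {κ σ : Type*} [LinearOrder κ] [LinearOrder σ] (α : σ →₀ ℕ)
    (s : Multiset κ) :
    (lexMultiset ⟨α, s⟩).sort (· ≤ ·) =
      (s.sort (· ≤ ·)).map Sum.inlₗ ++
        ((Finsupp.toMultiset α).sort (· ≤ ·)).map Sum.inrₗ := by
  refine List.Perm.eq_of_pairwise' (Multiset.pairwise_sort _ _) ?_ ?_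
  · rw [List.pairwise_append, List.pairwise_map, List.pairwise_map]
    refine ⟨?_, ?_, ?_⟩
    · simp
    · simp
    · simp
  · rw [← Multiset.coe_eq_coe, Multiset.sort_eq, ← Multiset.coe_add, ← Multiset.map_coe,
      ← Multiset.map_coe, Multiset.sort_eq, Multiset.sort_eq]
    rfl

theorem sort_toMultiset {n : ℕ} (α : Fin n →₀ ℕ) :
    (Finsupp.toMultiset α).sort (· ≤ ·) =
      (List.finRange n).flatMap fun i => List.replicate (α i) i := by
  refine List.Perm.eq_of_pairwise' (Multiset.pairwise_sort _ _) ?_ ?_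
  · rw [List.pairwise_flatMap]
    refine ⟨fun i _ => List.pairwise_replicate.2 (Or.inr le_rfl), ?_⟩
    refine (List.pairwise_lt_finRange n).imp fun {i j} hij x hx y hy => ?_
    rw [List.eq_of_mem_replicate hx, List.eq_of_mem_replicate hy]
    exact hij.le
  · rw [← Multiset.coe_eq_coe, Multiset.sort_eq]
    ext i
    rw [Finsupp.count_toMultiset, Multiset.coe_count, List.count_flatMap]
    simp only [Function.comp_def, List.count_replicate, beq_iff_eq]
    rw [← List.ofFn_eq_map, List.sum_ofFn]
    simp

theorem orderedMonomial_eq {K 𝔤 : Type*} [Field K] [LieRing 𝔤] [LieAlgebra K 𝔤]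
    {n : ℕ} (Y : Fin n → 𝔤) (α : Fin n →₀ ℕ) :
    orderedMonomial Y α = (((Finsupp.toMultiset α).sort (· ≤ ·)).map
      fun i => UniversalEnvelopingAlgebra.ι K (Y i)).prod := by
  rw [sort_toMultiset, List.map_flatMap, orderedMonomial, List.ofFn_eq_map, List.flatMap,
    List.prod_flatten]
  simp [Function.comp_def]

variable {K 𝔤 : Type*} [Field K] [LieRing 𝔤] [LieAlgebra K 𝔤]
  (𝔥 : LieSubalgebra K 𝔤) {n : ℕ} (Y : Fin n → 𝔤)

theorem envelopingIncl_ι (x : 𝔥) :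
    envelopingIncl 𝔥 (UniversalEnvelopingAlgebra.ι K x) = UniversalEnvelopingAlgebra.ι K (x : 𝔤) :=
  UniversalEnvelopingAlgebra.lift_ι_apply K _ x

theorem constantPart_ι (x : 𝔥) :
    constantPart 𝔥 (UniversalEnvelopingAlgebra.ι K x) = 0 :=
  UniversalEnvelopingAlgebra.lift_ι_apply K _ x

/-- `combination` as a linear map. -/
def combinationMap :
    ((Fin n →₀ ℕ) →₀ UniversalEnvelopingAlgebra K 𝔥) →ₗ[K] UniversalEnvelopingAlgebra K 𝔤 :=
  Finsupp.lsum K fun α => LinearMap.mulRight K (orderedMonomial Y α) ∘ₗ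
    (envelopingIncl 𝔥).toLinearMap

theorem combinationMap_apply (u : (Fin n →₀ ℕ) →₀ UniversalEnvelopingAlgebra K 𝔥) :
    combinationMap 𝔥 Y u = combination 𝔥 Y u :=
  rfl

theorem combination_single (α : Fin n →₀ ℕ) (v : UniversalEnvelopingAlgebra K 𝔥) :
    combination 𝔥 Y (Finsupp.single α v) = envelopingIncl 𝔥 v * orderedMonomial Y α := by
  simp [combination]

variable {𝔥 Y}

theorem combinationMap_bijective {V : Submodule K 𝔤} (hV : IsCompl 𝔥.toSubmodule V)
    (b : Module.Basis (Fin n) K V) (hY : ∀ i, Y i = (b i : 𝔤)) :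
    Function.Bijective (combinationMap 𝔥 Y) := by
  classical
  let κ := Module.Basis.ofVectorSpaceIndex K 𝔥
  let c : Module.Basis κ K 𝔥 := Module.Basis.ofVectorSpace K 𝔥
  let _ : LinearOrder κ := linearOrderOfSTO WellOrderingRel
  let B : Module.Basis (κ ⊕ₗ Fin n) K 𝔤 :=
    ((c.prod b).map (Submodule.prodEquivOfIsCompl _ _ hV)).reindex toLex
  have hBl : ∀ k, B (Sum.inlₗ k) = (c k : 𝔤) := fun k => by
    have := Submodule.coe_prodEquivOfIsCompl' _ _ hV (c k, 0)
    simp only [B, Module.Basis.reindex_apply, Module.Basis.map_apply]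
    exact (congrArg _ (c.prod_apply b (Sum.inl k))).trans (this.trans (add_zero _))
  have hBr : ∀ i, B (Sum.inrₗ i) = Y i := fun i => by
    have := Submodule.coe_prodEquivOfIsCompl' _ _ hV (0, b i)
    simp only [B, Module.Basis.reindex_apply, Module.Basis.map_apply, hY]
    exact (congrArg _ (c.prod_apply b (Sum.inr i))).trans (this.trans (zero_add _))
  let b₁ := Finsupp.basis fun _ : Fin n →₀ ℕ => pbwBasis c
  let b₂ := pbwBasis B
  let e := Equiv.ofBijective _ (lexMultiset_bijective κ (Fin n))
  -- The basis of pairs (α, ordered product of 𝔥) goes bijectively to the PBW basis of U(𝔤).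
  have h : combinationMap 𝔥 Y = (b₁.equiv b₂ e).toLinearMap := by
    refine b₁.ext fun p => ?_
    obtain ⟨α, s⟩ := p
    rw [LinearEquiv.coe_coe, Module.Basis.equiv_apply]
    simp only [b₁, b₂, Finsupp.coe_basis, combinationMap_apply, combination_single, e,
      Equiv.ofBijective_apply, pbwBasis_apply]
    simp only [sortedProduct, sort_lexMultiset, List.map_append, List.prod_append, List.map_map,
      Function.comp_def, hBl, hBr, orderedMonomial_eq, map_list_prod, envelopingIncl_ι]
  rw [h]
  exact (b₁.equiv b₂ e).bijective

theorem dual_apply_combination {α : Fin n →₀ ℕ}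
    {a : UniversalEnvelopingAlgebra K 𝔤 →ₗ[K] K} (ha : IsDualFunctional 𝔥 Y α a)
    (u : (Fin n →₀ ℕ) →₀ UniversalEnvelopingAlgebra K 𝔥) :
    a (combination 𝔥 Y u) = constantPart 𝔥 (u α) := by
  classical
  rw [← combinationMap_apply, ← LinearMap.comp_apply]
  suffices h : a ∘ₗ combinationMap 𝔥 Y =
      (constantPart 𝔥).toLinearMap ∘ₗ Finsupp.lapply α by rw [h]; rfl
  refine Finsupp.lhom_ext fun β v => ?_
  simp only [LinearMap.comp_apply, combinationMap_apply, combination_single, ha.1 v]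
  by_cases h : β = α
  · subst h; simp [ha.2.1]
  · simp [ha.2.2 β h, h]

variable (𝔥 Y) in
/-- The functional on `U(𝔤)` in `A` that sends `Y^α` to `c α`. -/
def functionalOf (hc : Function.Bijective (combinationMap 𝔥 Y)) (c : (Fin n →₀ ℕ) → K) :
    UniversalEnvelopingAlgebra K 𝔤 →ₗ[K] K :=
  Finsupp.lsum K (fun α => c α • (constantPart 𝔥).toLinearMap) ∘ₗ
    (LinearEquiv.ofBijective _ hc).symm.toLinearMap

theorem functionalOf_combination (hc : Function.Bijective (combinationMap 𝔥 Y))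
    (c : (Fin n →₀ ℕ) → K) (u : (Fin n →₀ ℕ) →₀ UniversalEnvelopingAlgebra K 𝔥) :
    functionalOf 𝔥 Y hc c (combination 𝔥 Y u) =
      u.sum fun α v => c α * constantPart 𝔥 v := by
  have : (LinearEquiv.ofBijective _ hc).symm (combination 𝔥 Y u) = u :=
    (LinearEquiv.ofBijective _ hc).symm_apply_apply u
  simp [functionalOf, this]
  rfl

theorem functionalOf_monomial (hc : Function.Bijective (combinationMap 𝔥 Y))
    (c : (Fin n →₀ ℕ) → K) (α : Fin n →₀ ℕ) :
    functionalOf 𝔥 Y hc c (orderedMonomial Y α) = c α := by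
  have := functionalOf_combination hc c (Finsupp.single α 1)
  simpa [combination_single] using this

theorem functionalOf_mem (hc : Function.Bijective (combinationMap 𝔥 Y))
    (c : (Fin n →₀ ℕ) → K) : functionalOf 𝔥 Y hc c ∈ coinduced 𝔥 := by
  intro v w
  obtain ⟨u, rfl⟩ := hc.2 w
  suffices h : functionalOf 𝔥 Y hc c ∘ₗ LinearMap.mulLeft K (envelopingIncl 𝔥 v) ∘ₗ
      combinationMap 𝔥 Y = constantPart 𝔥 v • functionalOf 𝔥 Y hc c ∘ₗ combinationMap 𝔥 Y from
    LinearMap.congr_fun h u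
  refine Finsupp.lhom_ext fun β w => ?_
  simp only [LinearMap.comp_apply, LinearMap.smul_apply, LinearMap.mulLeft_apply,
    combinationMap_apply]
  rw [combination_single, ← mul_assoc, ← map_mul, ← combination_single, ← combination_single,
    functionalOf_combination, functionalOf_combination, Finsupp.sum_single_index (by simp),
    Finsupp.sum_single_index (by simp), map_mul, smul_eq_mul]
  ring

theorem coinduced_ext (hc : Function.Bijective (combinationMap 𝔥 Y))
    {a a' : UniversalEnvelopingAlgebra K 𝔤 →ₗ[K] K} (ha : a ∈ coinduced 𝔥)
    (ha' : a' ∈ coinduced 𝔥) (h : ∀ α, a (orderedMonomial Y α) = a' (orderedMonomial Y α)) :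
    a = a' := by
  ext w
  obtain ⟨u, rfl⟩ := hc.2 w
  suffices h : a ∘ₗ combinationMap 𝔥 Y = a' ∘ₗ combinationMap 𝔥 Y from LinearMap.congr_fun h u
  refine Finsupp.lhom_ext fun β v => ?_
  simp only [LinearMap.comp_apply, combinationMap_apply, combination_single, ha v, ha' v, h β]

theorem dualFunctional_spec (hc : Function.Bijective (combinationMap 𝔥 Y)) (α : Fin n →₀ ℕ) :
    IsDualFunctional 𝔥 Y α (dualFunctional 𝔥 Y α) := by
  classical
  refine Classical.epsilon_spec (p := IsDualFunctional 𝔥 Y α)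
    ⟨functionalOf 𝔥 Y hc (Pi.single α 1), functionalOf_mem hc _, ?_, fun β hβ => ?_⟩
  · simp [functionalOf_monomial]
  · simp [functionalOf_monomial, hβ]

theorem IsDualFunctional.unique (hc : Function.Bijective (combinationMap 𝔥 Y))
    {α : Fin n →₀ ℕ} {a a' : UniversalEnvelopingAlgebra K 𝔤 →ₗ[K] K}
    (ha : IsDualFunctional 𝔥 Y α a) (ha' : IsDualFunctional 𝔥 Y α a') : a = a' := by
  refine coinduced_ext hc ha.1 ha'.1 fun β => ?_
  by_cases h : β = α
  · rw [h, ha.2.1, ha'.2.1]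
  · rw [ha.2.2 β h, ha'.2.2 β h]

end Combination

/-! ### Coproduct, convolution and Taylor series. -/

section Coproduct

open TensorProduct

attribute [local instance] LieRing.ofAssociativeRing

variable {K 𝔤 : Type*} [Field K] [LieRing 𝔤] [LieAlgebra K 𝔤]

variable (K 𝔤) in
/-- The coproduct of `U(𝔤)`, for which the elements of `𝔤` are primitive. -/
def coproduct : UniversalEnvelopingAlgebra K 𝔤 →ₐ[K]
    UniversalEnvelopingAlgebra K 𝔤 ⊗[K] UniversalEnvelopingAlgebra K 𝔤 :=
  UniversalEnvelopingAlgebra.lift K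
    { toFun := fun x => UniversalEnvelopingAlgebra.ι K x ⊗ₜ 1 + 1 ⊗ₜ UniversalEnvelopingAlgebra.ι K x
      map_add' := fun x y => by
        simp only [map_add, add_tmul, tmul_add]
        abel
      map_smul' := fun c x => by
        simp only [map_smul, smul_tmul', tmul_smul, smul_add, RingHom.id_apply]
      map_lie' := fun {x y} => by
        simp only [LieHom.map_lie, LieRing.of_associative_ring_bracket, mul_add, add_mul,
          Algebra.TensorProduct.tmul_mul_tmul, mul_one, one_mul, sub_tmul, tmul_sub]
        abel }

theorem coproduct_ι (x : 𝔤) : coproduct K 𝔤 (UniversalEnvelopingAlgebra.ι K x) =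
    UniversalEnvelopingAlgebra.ι K x ⊗ₜ 1 + 1 ⊗ₜ UniversalEnvelopingAlgebra.ι K x :=
  UniversalEnvelopingAlgebra.lift_ι_apply K _ x

/-- The functional `u ⊗ v ↦ a(u) b(v)`. -/
def tensorFunctional (a b : UniversalEnvelopingAlgebra K 𝔤 →ₗ[K] K) :
    UniversalEnvelopingAlgebra K 𝔤 ⊗[K] UniversalEnvelopingAlgebra K 𝔤 →ₗ[K] K :=
  LinearMap.mul' K K ∘ₗ TensorProduct.map a b

theorem tensorFunctional_tmul (a b : UniversalEnvelopingAlgebra K 𝔤 →ₗ[K] K)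
    (u v : UniversalEnvelopingAlgebra K 𝔤) : tensorFunctional a b (u ⊗ₜ v) = a u * b v := by
  simp [tensorFunctional]

/-- The convolution product of two functionals on `U(𝔤)`. -/
def convolution (a b : UniversalEnvelopingAlgebra K 𝔤 →ₗ[K] K) :
    UniversalEnvelopingAlgebra K 𝔤 →ₗ[K] K :=
  tensorFunctional a b ∘ₗ (coproduct K 𝔤).toLinearMap

theorem convolution_apply (a b : UniversalEnvelopingAlgebra K 𝔤 →ₗ[K] K)
    (u : UniversalEnvelopingAlgebra K 𝔤) :
    convolution a b u = tensorFunctional a b (coproduct K 𝔤 u) :=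
  rfl

theorem convolution_mem {𝔥 : LieSubalgebra K 𝔤} {a b : UniversalEnvelopingAlgebra K 𝔤 →ₗ[K] K}
    (ha : a ∈ coinduced 𝔥) (hb : b ∈ coinduced 𝔥) : convolution a b ∈ coinduced 𝔥 := by
  -- An arbitrary tensor w replaces Δ(u), so that the claim is multiplicative in v. For v ∈ 𝔥, both
  -- terms of v ⊗ 1 + 1 ⊗ v are annihilated.
  suffices h : ∀ v w, tensorFunctional a b (coproduct K 𝔤 (envelopingIncl 𝔥 v) * w) =
      constantPart 𝔥 v * tensorFunctional a b w by
    intro v u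
    rw [convolution_apply, map_mul, h, convolution_apply]
  intro v
  induction v using enveloping_induction with
  | algebraMap c =>
    intro w
    rw [AlgHom.commutes, AlgHom.commutes, AlgHom.commutes, ← Algebra.smul_def, map_smul, smul_eq_mul, Algebra.algebraMap_self_apply]
  | ι x =>
    intro w
    rw [envelopingIncl_ι, constantPart_ι, zero_mul, coproduct_ι]
    induction w using TensorProduct.induction_on with
    | zero => simp
    | add w w' h h' => rw [mul_add, map_add, h, h', add_zero]
    | tmul u u' =>
      rw [add_mul, Algebra.TensorProduct.tmul_mul_tmul, Algebra.TensorProduct.tmul_mul_tmul,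
        map_add, tensorFunctional_tmul, tensorFunctional_tmul, ← envelopingIncl_ι, ha, hb,
        constantPart_ι]
      simp
  | add v v' h h' => intro w; simp only [map_add, add_mul, h, h']
  | mul v v' h h' => intro w; simp only [map_mul, mul_assoc, h, h']

/-- The action of `X` on functionals by right multiplication of the argument. -/
def translate (X : 𝔤) (a : UniversalEnvelopingAlgebra K 𝔤 →ₗ[K] K) :
    UniversalEnvelopingAlgebra K 𝔤 →ₗ[K] K :=
  a ∘ₗ LinearMap.mulRight K (UniversalEnvelopingAlgebra.ι K X)

theorem translate_apply (X : 𝔤) (a : UniversalEnvelopingAlgebra K 𝔤 →ₗ[K] K)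
    (u : UniversalEnvelopingAlgebra K 𝔤) :
    translate X a u = a (u * UniversalEnvelopingAlgebra.ι K X) :=
  rfl

theorem translate_mem {𝔥 : LieSubalgebra K 𝔤} (X : 𝔤)
    {a : UniversalEnvelopingAlgebra K 𝔤 →ₗ[K] K} (ha : a ∈ coinduced 𝔥) :
    translate X a ∈ coinduced 𝔥 := fun v u => by
  rw [translate_apply, translate_apply, mul_assoc, ha]

/-- Leibniz rule: Δ(uX) = Δ(u)(X ⊗ 1 + 1 ⊗ X). -/
theorem translate_convolution (X : 𝔤) (a b : UniversalEnvelopingAlgebra K 𝔤 →ₗ[K] K) :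
    translate X (convolution a b) =
      convolution (translate X a) b + convolution a (translate X b) := by
  ext u
  simp only [translate_apply, LinearMap.add_apply, convolution_apply, map_mul, coproduct_ι]
  induction coproduct K 𝔤 u using TensorProduct.induction_on with
  | zero => simp
  | add w w' h h' => simp only [add_mul, map_add, h, h']; ring
  | tmul v v' =>
    simp [mul_add, Algebra.TensorProduct.tmul_mul_tmul, tensorFunctional_tmul, translate_apply]

/-- The product of divided powers `Y₁^α₁/α₁! ⋯ Yₙ^αₙ/αₙ!` in `U(𝔤)`. -/
def dividedMonomial {n : ℕ} (Y : Fin n → 𝔤) (α : Fin n →₀ ℕ) :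
    UniversalEnvelopingAlgebra K 𝔤 :=
  (((∏ j, (α j).factorial : ℕ) : K))⁻¹ • orderedMonomial Y α

theorem dividedMonomial_cons {n : ℕ} (Y : Fin (n + 1) → 𝔤) (k : ℕ) (α : Fin n →₀ ℕ) :
    dividedMonomial (K := K) Y (Finsupp.cons k α) =
      ((k.factorial : K)⁻¹ • UniversalEnvelopingAlgebra.ι K (Y 0) ^ k) *
        dividedMonomial (fun i => Y i.succ) α := by
  simp only [dividedMonomial, orderedMonomial, List.ofFn_succ, List.prod_cons, Fin.prod_univ_succ,
    Finsupp.cons_zero, Finsupp.cons_succ, Nat.cast_mul, mul_inv, smul_mul_smul_comm]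

theorem sum_antidiagonal_cons {M : Type*} [AddCommMonoid M] {n : ℕ} (k : ℕ) (α : Fin n →₀ ℕ)
    (F : (Fin (n + 1) →₀ ℕ) × (Fin (n + 1) →₀ ℕ) → M) :
    ∑ p ∈ Finset.HasAntidiagonal.antidiagonal (Finsupp.cons k α), F p =
      ∑ q ∈ Finset.HasAntidiagonal.antidiagonal k, ∑ p ∈ Finset.HasAntidiagonal.antidiagonal α,
        F (Finsupp.cons q.1 p.1, Finsupp.cons q.2 p.2) := by
  rw [← Finset.sum_product']
  symm
  refine Finset.sum_nbij' (fun x => (Finsupp.cons x.1.1 x.2.1, Finsupp.cons x.1.2 x.2.2))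
    (fun p => ((p.1 0, p.2 0), (p.1.tail, p.2.tail))) ?_ ?_ ?_ ?_ ?_
  · rintro ⟨⟨i, j⟩, ⟨β, γ⟩⟩ h
    simp only [Finset.mem_product, Finset.HasAntidiagonal.mem_antidiagonal] at h ⊢
    rw [← h.1, ← h.2]
    ext l
    refine Fin.cases ?_ (fun l => ?_) l <;> simp
  · rintro ⟨β, γ⟩ h
    simp only [Finset.mem_product, Finset.HasAntidiagonal.mem_antidiagonal] at h ⊢
    constructor
    · simpa using DFunLike.congr_fun h 0
    · ext l
      simpa [Finsupp.tail_apply] using DFunLike.congr_fun h l.succ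
  · rintro ⟨⟨i, j⟩, ⟨β, γ⟩⟩ _
    simp
  · rintro ⟨β, γ⟩ _
    simp
  · intro _ _
    rfl

/-- The Taylor series `∑_α a(Y^α) / α! · x^α` of a functional `a`. -/
def taylor {n : ℕ} (Y : Fin n → 𝔤) :
    (UniversalEnvelopingAlgebra K 𝔤 →ₗ[K] K) →ₗ[K] MvPowerSeries (Fin n) K where
  toFun a := fun α => a (dividedMonomial Y α)
  map_add' _ _ := rfl
  map_smul' _ _ := rfl

theorem coeff_taylor {n : ℕ} (Y : Fin n → 𝔤) (a : UniversalEnvelopingAlgebra K 𝔤 →ₗ[K] K)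
    (α : Fin n →₀ ℕ) : MvPowerSeries.coeff α (taylor Y a) = a (dividedMonomial Y α) :=
  rfl

variable [CharZero K]

/-- The binomial theorem for the commuting elements x ⊗ 1 and 1 ⊗ x; dividing by k! absorbs the
binomial coefficients. -/
theorem coproduct_dividedPower (x : 𝔤) (k : ℕ) :
    coproduct K 𝔤 ((k.factorial : K)⁻¹ • UniversalEnvelopingAlgebra.ι K x ^ k) =
      ∑ q ∈ Finset.HasAntidiagonal.antidiagonal k,
        ((q.1.factorial : K)⁻¹ • UniversalEnvelopingAlgebra.ι K x ^ q.1) ⊗ₜ[K]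
          ((q.2.factorial : K)⁻¹ • UniversalEnvelopingAlgebra.ι K x ^ q.2) := by
  rw [map_smul, map_pow, coproduct_ι, Commute.add_pow', Finset.smul_sum]
  · refine Finset.sum_congr rfl fun q hq => ?_
    rw [Finset.HasAntidiagonal.mem_antidiagonal] at hq
    subst hq
    have hc : ((q.1 + q.2).factorial : K)⁻¹ * ((q.1 + q.2).choose q.1 : K) =
        (q.1.factorial : K)⁻¹ * (q.2.factorial : K)⁻¹ := by
      have h := congrArg (Nat.cast : ℕ → K) (Nat.add_choose_mul_factorial_mul_factorial q.1 q.2)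
      rw [← Nat.choose_symm_add] at h
      push_cast at h
      have h1 := Nat.cast_ne_zero (R := K).2 (Nat.factorial_ne_zero q.1)
      have h2 := Nat.cast_ne_zero (R := K).2 (Nat.factorial_ne_zero q.2)
      have h3 := Nat.cast_ne_zero (R := K).2 (Nat.factorial_ne_zero (q.1 + q.2))
      field_simp
      linear_combination h
    rw [← Nat.cast_smul_eq_nsmul K, smul_smul, hc, Algebra.TensorProduct.tmul_pow,
      Algebra.TensorProduct.tmul_pow, Algebra.TensorProduct.tmul_mul_tmul, smul_tmul_smul]
    simp
  · simp [Commute, SemiconjBy, Algebra.TensorProduct.tmul_mul_tmul]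

theorem coproduct_dividedMonomial {n : ℕ} (Y : Fin n → 𝔤) (α : Fin n →₀ ℕ) :
    coproduct K 𝔤 (dividedMonomial Y α) =
      ∑ p ∈ Finset.HasAntidiagonal.antidiagonal α, dividedMonomial Y p.1 ⊗ₜ[K] dividedMonomial Y p.2 := by
  induction n with
  | zero =>
    obtain rfl : α = 0 := Subsingleton.elim _ _
    simp [dividedMonomial, orderedMonomial, Algebra.TensorProduct.one_def]
  | succ n ih =>
    rw [← Finsupp.cons_tail α, dividedMonomial_cons, map_mul, coproduct_dividedPower, ih,
      Finset.sum_mul_sum, sum_antidiagonal_cons]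
    simp only [dividedMonomial_cons, Algebra.TensorProduct.tmul_mul_tmul]

/-- The coproduct of a divided monomial runs over the same pairs as the Cauchy product of power
series. -/
theorem taylor_convolution {n : ℕ} (Y : Fin n → 𝔤)
    (a b : UniversalEnvelopingAlgebra K 𝔤 →ₗ[K] K) :
    taylor Y (convolution a b) = taylor Y a * taylor Y b := by
  ext α
  rw [MvPowerSeries.coeff_mul, coeff_taylor, convolution_apply, coproduct_dividedMonomial, map_sum]
  simp only [tensorFunctional_tmul, coeff_taylor]

end Coproduct

/-! ### Formal vector fields: values on the variables, and order. -/

theorem mvPowerSeries_exists_eq_sum_X_mul {R : Type*} [CommRing R] {n : ℕ}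
    (f : MvPowerSeries (Fin n) R) :
    ∃ g : Fin n → MvPowerSeries (Fin n) R,
      f = MvPowerSeries.C (MvPowerSeries.constantCoeff f) + ∑ i, MvPowerSeries.X i * g i := by
  classical
  have hpick : ∀ d : Fin n →₀ ℕ, d ≠ 0 → ∃ i, d i ≠ 0 := fun d hd => Finsupp.ne_iff.1 hd
  choose pick hpick using hpick
  -- Each non-constant monomial is assigned to one variable dividing it; `g i` collects those
  -- assigned to i, divided by x_i.
  let g : Fin n → MvPowerSeries (Fin n) R := fun i d =>
    if ∃ h, pick (d + Finsupp.single i 1) h = i then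
      MvPowerSeries.coeff (d + Finsupp.single i 1) f else 0
  have hg : ∀ i d, MvPowerSeries.coeff d (g i) =
      if ∃ h, pick (d + Finsupp.single i 1) h = i then
        MvPowerSeries.coeff (d + Finsupp.single i 1) f else 0 := fun _ _ => rfl
  refine ⟨g, ?_⟩
  ext d
  rw [map_add, map_sum, MvPowerSeries.coeff_C]
  by_cases hd : d = 0
  · subst hd
    simp
  · have h : ∀ i : Fin n, MvPowerSeries.coeff d (MvPowerSeries.X i * g i) =
        if i = pick d hd then MvPowerSeries.coeff d f else 0 := by
      intro i
      rw [MvPowerSeries.X_def, MvPowerSeries.coeff_monomial_mul, hg]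
      split_ifs with h1 h2 h3 h3 h3
      · rw [tsub_add_cancel_of_le h1, one_mul]
      · simp only [tsub_add_cancel_of_le h1] at h2
        exact absurd h2.2.symm h3
      · simp only [tsub_add_cancel_of_le h1] at h2
        exact absurd ⟨hd, h3.symm⟩ h2
      · rw [mul_zero]
      · exact absurd (Finsupp.single_le_iff.2 (Nat.one_le_iff_ne_zero.2 (h3 ▸ hpick d hd))) h1
      · rfl
    rw [Finset.sum_congr rfl fun i _ => h i]
    simp [hd]

/-- No continuity is needed: D - D' kills constants and variables, so it maps c + ∑ x_i g_i to ∑ x_i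
(D - D') g_i. Iterating pushes the order of the image beyond every bound. -/
theorem VectorField.eq_of_apply_X {K : Type*} [Field K] {n : ℕ}
    {D D' : VectorField K n}
    (h : ∀ i, D (MvPowerSeries.X i) = D' (MvPowerSeries.X i)) : D = D' := by
  have key : ∀ (k : ℕ) (f : MvPowerSeries (Fin n) K) (d : Fin n →₀ ℕ), d.degree < k →
      MvPowerSeries.coeff d ((D - D') f) = 0 := by
    intro k
    induction k with
    | zero => intro f d hd; omega
    | succ k ih =>
      intro f d hd
      obtain ⟨g, hg⟩ := mvPowerSeries_exists_eq_sum_X_mul f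
      have hC : (D - D') (MvPowerSeries.C (MvPowerSeries.constantCoeff f)) = 0 :=
        (D - D').map_algebraMap (MvPowerSeries.constantCoeff f)
      rw [hg, map_add, hC, zero_add, map_sum, map_sum]
      refine Finset.sum_eq_zero fun i _ => ?_
      rw [Derivation.leibniz, Derivation.sub_apply (MvPowerSeries.X i), h i, sub_self,
        smul_zero, add_zero, smul_eq_mul, MvPowerSeries.X_def, MvPowerSeries.coeff_monomial_mul]
      split_ifs with hle
      · rw [ih, mul_zero]
        have := congrArg Finsupp.degree (tsub_add_cancel_of_le hle)
        rw [map_add, Finsupp.degree_single] at this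
        omega
      · rfl
  rw [← sub_eq_zero]
  ext f d
  simpa using key _ f d (Nat.lt_succ_self _)

theorem VectorField.zero_le_order_iff {K : Type*} [Field K] {n : ℕ}
    (D : VectorField K n) :
    0 ≤ D.order ↔ ∀ i, MvPowerSeries.constantCoeff (D (MvPowerSeries.X i)) = 0 := by
  simp only [VectorField.order, ← MvPowerSeries.one_le_order_iff_constCoeff_eq_zero]
  rw [← le_iInf_iff]
  generalize (⨅ i : Fin n, (D (MvPowerSeries.X i)).order) = e
  induction e using ENat.recTopCoe with
  | top => simp
  | coe m =>
    have h : ((m : ℤ) : WithTop ℤ) + ((-1 : ℤ) : WithTop ℤ) = ((m - 1 : ℤ) : WithTop ℤ) := rfl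
    have h0 : (0 : WithTop ℤ) = ((0 : ℤ) : WithTop ℤ) := rfl
    rw [ENat.map_natCast, h, h0, WithTop.coe_le_coe]
    rw [Nat.one_le_cast]
    omega

/-! ### The action on A as vector fields, and the realisation. -/

section Realisation

attribute [local instance] LieRing.ofAssociativeRing

variable {K 𝔤 : Type*} [Field K] [LieRing 𝔤] [LieAlgebra K 𝔤]
  {𝔥 : LieSubalgebra K 𝔤} {n : ℕ} {Y : Fin n → 𝔤}

theorem realisationFormula_apply_X (X : 𝔤) (i : Fin n) :
    realisationFormula 𝔥 Y X (MvPowerSeries.X i) = realisationCoeff 𝔥 Y X i := by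
  classical
  have h := congrFun (map_sum Derivation.coeFnAddMonoidHom
    (fun i => realisationCoeff 𝔥 Y X i • MvPowerSeries.pderiv K i) Finset.univ) (MvPowerSeries.X i)
  rw [Finset.sum_apply] at h
  refine h.trans ?_
  simp only [Derivation.coeFnAddMonoidHom_apply]
  rw [Finset.sum_eq_single i]
  · simp
  · intro j _ hj
    rw [Derivation.smul_apply, MvPowerSeries.pderiv_X_of_ne (Ne.symm hj), smul_zero]
  · simp

theorem constantCoeff_realisationCoeff (X : 𝔤)
    (i : Fin n) : MvPowerSeries.constantCoeff (realisationCoeff 𝔥 Y X i) =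
      dualFunctional 𝔥 Y (Finsupp.single i 1) (UniversalEnvelopingAlgebra.ι K X) := by
  rw [← MvPowerSeries.coeff_zero_eq_constantCoeff_apply]
  change dualFunctional 𝔥 Y _ (orderedMonomial Y 0 * UniversalEnvelopingAlgebra.ι K X) / _ = _
  simp [orderedMonomial]

theorem orderedMonomial_single (i : Fin n) :
    orderedMonomial (K := K) Y (Finsupp.single i 1) = UniversalEnvelopingAlgebra.ι K (Y i) := by
  rw [orderedMonomial_eq]
  simp

/-- The action of `X` on `A`. -/
def coinducedAction (𝔥 : LieSubalgebra K 𝔤) (X : 𝔤) : coinduced 𝔥 →ₗ[K] coinduced 𝔥 where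
  toFun a := ⟨translate X a, translate_mem X a.2⟩
  map_add' _ _ := rfl
  map_smul' _ _ := rfl

theorem coe_coinducedAction (X : 𝔤) (a : coinduced 𝔥) :
    (coinducedAction 𝔥 X a : UniversalEnvelopingAlgebra K 𝔤 →ₗ[K] K) = translate X a :=
  rfl

variable [CharZero K]

theorem taylor_bijective (hc : Function.Bijective (combinationMap 𝔥 Y)) :
    Function.Bijective (taylor Y ∘ₗ (coinduced 𝔥).subtype) := by
  have hne : ∀ α : Fin n →₀ ℕ, ((∏ j, (α j).factorial : ℕ) : K) ≠ 0 := fun α =>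
    Nat.cast_ne_zero.2 (Finset.prod_ne_zero_iff.2 fun j _ => Nat.factorial_ne_zero _)
  constructor
  · rintro ⟨a, ha⟩ ⟨a', ha'⟩ h
    refine Subtype.ext (coinduced_ext hc ha ha' fun α => ?_)
    have h' : a (dividedMonomial Y α) = a' (dividedMonomial Y α) :=
      congrArg (MvPowerSeries.coeff α) h
    rw [dividedMonomial, map_smul, map_smul] at h'
    exact smul_right_injective _ (inv_ne_zero (hne α)) h'
  · intro f
    refine ⟨⟨functionalOf 𝔥 Y hc fun α =>
      ((∏ j, (α j).factorial : ℕ) : K) * MvPowerSeries.coeff α f, functionalOf_mem hc _⟩, ?_⟩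
    ext α
    change functionalOf 𝔥 Y hc _ (dividedMonomial Y α) = _
    rw [dividedMonomial, map_smul, functionalOf_monomial, smul_eq_mul,
      inv_mul_cancel_left₀ (hne α)]

/-- The isomorphism of `A` with the ring of power series given by Taylor series. -/
def taylorEquiv (hc : Function.Bijective (combinationMap 𝔥 Y)) :
    coinduced 𝔥 ≃ₗ[K] MvPowerSeries (Fin n) K :=
  LinearEquiv.ofBijective _ (taylor_bijective hc)

theorem taylorEquiv_apply (hc : Function.Bijective (combinationMap 𝔥 Y)) (a : coinduced 𝔥) :
    taylorEquiv hc a = taylor Y (a : UniversalEnvelopingAlgebra K 𝔤 →ₗ[K] K) :=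
  rfl

/-- The formal vector field corresponding to the action of `X` on `A`. -/
def actionField (hc : Function.Bijective (combinationMap 𝔥 Y)) (X : 𝔤) : VectorField K n :=
  Derivation.mk' ((taylorEquiv hc).toLinearMap ∘ₗ coinducedAction 𝔥 X ∘ₗ
    (taylorEquiv hc).symm.toLinearMap) fun f g => by
      obtain ⟨a, rfl⟩ := (taylorEquiv hc).surjective f
      obtain ⟨b, rfl⟩ := (taylorEquiv hc).surjective g
      -- Products of series are convolutions in A, so the Leibniz rule for translation carries over.
      have h : taylorEquiv hc a * taylorEquiv hc b =
          taylorEquiv hc ⟨convolution a b, convolution_mem a.2 b.2⟩ :=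
        (taylor_convolution Y _ _).symm
      rw [h]
      simp only [LinearMap.comp_apply, LinearEquiv.coe_coe, LinearEquiv.symm_apply_apply]
      simp only [taylorEquiv_apply, coe_coinducedAction, translate_convolution, map_add,
        taylor_convolution, smul_eq_mul]
      ring

theorem actionField_taylor (hc : Function.Bijective (combinationMap 𝔥 Y)) (X : 𝔤)
    (a : coinduced 𝔥) :
    actionField hc X (taylorEquiv hc a) = taylorEquiv hc (coinducedAction 𝔥 X a) := by
  simp [actionField]

theorem taylor_dualFunctional (hc : Function.Bijective (combinationMap 𝔥 Y)) (i : Fin n) :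
    taylorEquiv hc ⟨dualFunctional 𝔥 Y (Finsupp.single i 1), (dualFunctional_spec hc _).1⟩ =
      MvPowerSeries.X i := by
  classical
  obtain ⟨_, h1, h0⟩ := dualFunctional_spec hc (Finsupp.single i 1)
  ext α
  rw [taylorEquiv_apply, coeff_taylor, dividedMonomial, map_smul, MvPowerSeries.coeff_X]
  split_ifs with h
  · subst h
    have : ∏ j, (Finsupp.single i 1 j).factorial = 1 := Finset.prod_eq_one fun j _ => by
      by_cases hj : j = i
      · subst hj; simp
      · simp [hj]
    simp [h1, this]
  · simp [h0 α h]

/-- Both derivations agree on x_i, the Taylor series of a_{e_i}: the coefficients a_{e_i}(Y^α X)/α!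
are those of the translate X · a_{e_i}. -/
theorem realisationFormula_eq (hc : Function.Bijective (combinationMap 𝔥 Y)) (X : 𝔤) :
    realisationFormula 𝔥 Y X = actionField hc X := by
  refine VectorField.eq_of_apply_X fun i => ?_
  rw [realisationFormula_apply_X, ← taylor_dualFunctional hc i, actionField_taylor]
  ext α
  rw [taylorEquiv_apply, coeff_taylor]
  change dualFunctional 𝔥 Y _ (orderedMonomial Y α * UniversalEnvelopingAlgebra.ι K X) / _ =
    dualFunctional 𝔥 Y _ (dividedMonomial Y α * UniversalEnvelopingAlgebra.ι K X)
  rw [dividedMonomial, smul_mul_assoc, map_smul, smul_eq_mul, div_eq_inv_mul]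

/-- The realisation as a homomorphism of Lie algebras. -/
def realisation (hc : Function.Bijective (combinationMap 𝔥 Y)) : 𝔤 →ₗ⁅K⁆ VectorField K n where
  toFun X := realisationFormula 𝔥 Y X
  map_add' X X' := by
    simp only [realisationFormula_eq hc]
    ext1 f
    obtain ⟨a, rfl⟩ := (taylorEquiv hc).surjective f
    rw [Derivation.add_apply]
    simp only [actionField_taylor, ← map_add]
    congr 1
    ext u
    simp [coe_coinducedAction, translate_apply, mul_add]
  map_smul' c X := by
    simp only [realisationFormula_eq hc]
    ext1 f
    obtain ⟨a, rfl⟩ := (taylorEquiv hc).surjective f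
    rw [Derivation.smul_apply]
    simp only [actionField_taylor, ← map_smul]
    congr 1
    ext u
    simp [coe_coinducedAction, translate_apply]
  map_lie' {X X'} := by
    simp only [realisationFormula_eq hc]
    ext1 f
    obtain ⟨a, rfl⟩ := (taylorEquiv hc).surjective f
    rw [Derivation.commutator_apply]
    simp only [actionField_taylor, ← map_sub]
    congr 1
    -- Acting by X' and then by X evaluates a at u X X', so the order of factors is preserved and no
    -- sign appears.
    ext u
    simp [coe_coinducedAction, translate_apply, LieRing.of_associative_ring_bracket, mul_sub, mul_assoc]

theorem isRealisation_realisation {V : Submodule K 𝔤} (hV : IsCompl 𝔥.toSubmodule V)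
    (b : Module.Basis (Fin n) K V) (hY : ∀ i, Y i = (b i : 𝔤))
    (hc : Function.Bijective (combinationMap 𝔥 Y)) : IsRealisation 𝔥 (realisation hc) where
  codim_eq := by
    rw [(Submodule.quotientEquivOfIsCompl _ _ hV).rank_eq, rank_eq_card_basis b, Fintype.card_fin]
  mem_iff X := by
    rw [VectorField.zero_le_order_iff]
    have hX : ∀ i, MvPowerSeries.constantCoeff (realisation hc X (MvPowerSeries.X i)) =
        dualFunctional 𝔥 Y (Finsupp.single i 1) (UniversalEnvelopingAlgebra.ι K X) := fun i =>
      (congrArg _ (realisationFormula_apply_X X i)).trans (constantCoeff_realisationCoeff X i)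
    have h𝔥 : ∀ (x : 𝔤) (i : Fin n), x ∈ 𝔥 →
        dualFunctional 𝔥 Y (Finsupp.single i 1) (UniversalEnvelopingAlgebra.ι K x) = 0 := by
      intro x i hx
      have := (dualFunctional_spec hc (Finsupp.single i 1)).1
        (UniversalEnvelopingAlgebra.ι K ⟨x, hx⟩) 1
      simpa only [envelopingIncl_ι, constantPart_ι, mul_one, zero_mul] using this
    simp only [hX]
    refine ⟨fun h i => h𝔥 X i h, fun h => ?_⟩
    obtain ⟨x, hx, v, hv, rfl⟩ := Submodule.mem_sup.1
      (hV.sup_eq_top ▸ Submodule.mem_top : X ∈ 𝔥.toSubmodule ⊔ V)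
    -- On x + v with x ∈ 𝔥, a_{e_i} ignores x and reads off the i-th coordinate of v.
    have hv0 : b.repr ⟨v, hv⟩ = 0 := by
      ext i
      obtain ⟨_, h1, h0⟩ := dualFunctional_spec hc (Finsupp.single i 1)
      have hi := h i
      have hsum : v = ∑ j, b.repr ⟨v, hv⟩ j • Y j := by
        simp only [hY]
        simpa only [Submodule.coe_sum, Submodule.coe_smul] using
          (congrArg Subtype.val (b.sum_repr ⟨v, hv⟩)).symm
      rw [map_add, map_add, h𝔥 x i hx, zero_add, hsum, map_sum, map_sum,
        Finset.sum_eq_single i] at hi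
      · rw [map_smul, map_smul, ← orderedMonomial_single, h1, smul_eq_mul, mul_one] at hi
        exact hi
      · intro j _ hj
        rw [map_smul, map_smul, ← orderedMonomial_single, h0, smul_zero]
        intro he
        exact hj ((Finsupp.single_left_inj one_ne_zero).1 he)
      · simp
    have hv' : v = 0 := congrArg Subtype.val ((b.repr.map_eq_zero_iff).1 hv0)
    rw [hv', add_zero]
    exact hx

end Realisation

end TransitiveLie

end

open TransitiveLie in
theorem mainTheorem2 {K : Type*} [Field K] [CharZero K]
    {𝔤 : Type*} [LieRing 𝔤] [LieAlgebra K 𝔤]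
    (𝔥 : LieSubalgebra K 𝔤) (hpair : IsTransitivePair 𝔥)
    (V : Submodule K 𝔤) (hV : IsCompl 𝔥.toSubmodule V)
    (n : ℕ) (b : Module.Basis (Fin n) K V)
    (Y : Fin n → 𝔤) (hY : ∀ i, Y i = (b i : 𝔤)) :
    -- every element of `U(𝔤)` is uniquely a `U(𝔥)`-combination of ordered monomials
    Function.Bijective (combination 𝔥 Y) ∧
    -- `a_α` is the unique element of `A` dual to `Y^α`
    (∀ α, IsDualFunctional 𝔥 Y α (dualFunctional 𝔥 Y α) ∧
      ∀ a, IsDualFunctional 𝔥 Y α a → a = dualFunctional 𝔥 Y α) ∧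
    -- `a_α` reads off the constant part of the coefficient of `Y^α`
    (∀ α u, dualFunctional 𝔥 Y α (combination 𝔥 Y u) = constantPart 𝔥 (u α)) ∧
    -- the formula is a Lie algebra homomorphism and a realisation
    ∃ φ : 𝔤 →ₗ⁅K⁆ VectorField K n,
      (∀ X, φ X = realisationFormula 𝔥 Y X) ∧ IsRealisation 𝔥 φ := by
  have hc := combinationMap_bijective hV b hY
  exact ⟨hc, fun α => ⟨dualFunctional_spec hc α, fun a ha => ha.unique hc (dualFunctional_spec hc α)⟩,
    fun α u => dual_apply_combination (dualFunctional_spec hc α) u,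
    realisation hc, fun _ => rfl, isRealisation_realisation hV b hY hc⟩
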